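/- Let $n\ge 2$ be an integer, $p\in[1,\infty]$, $q\in[1,\infty)$ and $s\in(0,1)$. Let $M^{s;q,p}(\mathbb R^n)$ be the Banach space obtained as the completion of the space $C^1_c(\mathbb R^n)$ of compactly supported real-valued $C^1$ functions with respect to the norm $\|u\|_{L^q(\mathbb R^n)}+[u]_{s,p}$, where $$[u]_{s,p}:=\Big(\int_{\mathbb R^n}\int_{\mathbb R^n}\frac{|u(x)-u(y)|^p}{|x-y|^{n+sp}}\,dx\,dy\Big)^{1/p}\ \text{ if } p<\infty,\qquad [u]_{s,\infty}:=\operatorname*{ess\,sup}_{(x,y)\in\mathbb R^n\times\mathbb R^n}\frac{|u(x)-u(y)|}{|x-y|^{s}} .$$ Say that $M^{s;q,p}(\mathbb R^n)$ embeds continuously into $L^r(\mathbb R^n)$ if the inclusion $C^1_c(\mathbb R^n)\subset L^r(\mathbb R^n)$ extends to an injective continuous linear map $\iota:M^{s;q,p}(\mathbb R^n)\to L^r(\mathbb R^n)$. Then: 1. if $sp<n$, then, with $p^*_s:=\frac{np}{n-sp}$, $M^{s;q,p}(\mathbb R^n)$ embeds continuously into $L^r(\mathbb R^n)$ for every $r$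 with $\min\{p^*_s,q\}\le r\le\max\{p^*_s,q\}$; 2. if $sp=n$, then $M^{s;q,p}(\mathbb R^n)$ embeds continuously into $L^r(\mathbb R^n)$ for every $r$ with $q\le r<\infty$; 3. if $sp>n$ (which includes $p=\infty$), then $M^{s;q,p}(\mathbb R^n)$ embeds continuously into $L^r(\mathbb R^n)$ for every $r$ with $q\le r\le\infty$. -/

import Mathlib

open MeasureTheory Set
open scoped ENNReal NNReal

noncomputable section

namespace FracSobolev

/-- The quotient `(u x - u y) / |x - y| ^ (n / p + s)`, as a function on `ℝⁿ × ℝⁿ`.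
For `p = ∞`, `p.toReal = 0`, so the exponent is `n / 0 + s = s`, as it should be. -/
def diffQuot (n : ℕ) (s : ℝ) (p : ℝ≥0∞) (u : EuclideanSpace ℝ (Fin n) → ℝ) :
    EuclideanSpace ℝ (Fin n) × EuclideanSpace ℝ (Fin n) → ℝ :=
  fun z => (u z.1 - u z.2) / ‖z.1 - z.2‖ ^ ((n : ℝ) / p.toReal + s)

/-- The Gagliardo seminorm `[u]_{s,p}`: the `L^p(ℝⁿ × ℝⁿ)` norm of the quotient above, that is,
`(∬ |u x - u y| ^ p / |x - y| ^ (n + s p) dx dy) ^ (1 / p)` for `p < ∞`, and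
the essential supremum of `|u x - u y| / |x - y| ^ s` for `p = ∞`. -/
def gagliardo (n : ℕ) (s : ℝ) (p : ℝ≥0∞) (u : EuclideanSpace ℝ (Fin n) → ℝ) : ℝ≥0∞ :=
  eLpNorm (diffQuot n s p u) p
    ((volume : Measure (EuclideanSpace ℝ (Fin n))).prod volume)

/-- The vector space `C^1_c(ℝⁿ)` of compactly supported `C^1` functions. -/
def C1c (n : ℕ) : Submodule ℝ (EuclideanSpace ℝ (Fin n) → ℝ) where
  carrier := {u | ContDiff ℝ 1 u ∧ HasCompactSupport u}
  zero_mem' := ⟨contDiff_const, HasCompactSupport.zero⟩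
  add_mem' := fun hu hv => ⟨hu.1.add hv.1, hu.2.add hv.2⟩
  smul_mem' := fun c _ hu => ⟨hu.1.const_smul c, hu.2.smul_left (f := fun _ => c)⟩

/-- `C^1_c(ℝⁿ)`, to be normed by `‖u‖_q + [u]_{s,p}`. -/
def Pre (n : ℕ) (_s : Set.Ioo (0 : ℝ) 1) (_q _p : ℝ≥0∞) : Type := C1c n

variable {n : ℕ}

lemma diffQuot_measurable (s : ℝ) (p : ℝ≥0∞) {u : EuclideanSpace ℝ (Fin n) → ℝ}
    (hu : Continuous u) : Measurable (diffQuot n s p u) := by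
  have := hu.measurable
  unfold diffQuot
  fun_prop

lemma diffQuot_add (s : ℝ) (p : ℝ≥0∞) (u v : EuclideanSpace ℝ (Fin n) → ℝ) :
    diffQuot n s p (u + v) = diffQuot n s p u + diffQuot n s p v := by
  funext z
  simp only [diffQuot, Pi.add_apply]
  ring

lemma diffQuot_smul (s : ℝ) (p : ℝ≥0∞) (c : ℝ) (u : EuclideanSpace ℝ (Fin n) → ℝ) :
    diffQuot n s p (c • u) = c • diffQuot n s p u := by
  funext z
  simp only [diffQuot, Pi.smul_apply, smul_eq_mul]
  ring

/-- A compactly supported `C^1` function is bounded and Lipschitz. -/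
lemma C1c.exists_bound {u : EuclideanSpace ℝ (Fin n) → ℝ} (hu : u ∈ C1c n) :
    ∃ C : ℝ, 0 ≤ C ∧ ∀ x y, |u x - u y| ≤ C * min ‖x - y‖ 1 := by
  obtain ⟨h1, h2⟩ := hu
  obtain ⟨K, hK⟩ := h1.lipschitzWith_of_hasCompactSupport h2 (by simp)
  obtain ⟨M, hM⟩ := h2.exists_bound_of_continuous h1.continuous
  have hM0 : 0 ≤ M := (norm_nonneg _).trans (hM 0)
  refine ⟨max K (2 * M), le_max_of_le_left K.2, fun x y => ?_⟩
  rcases le_total ‖x - y‖ 1 with h | h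
  · rw [min_eq_left h]
    have := hK.dist_le_mul x y
    rw [Real.dist_eq, dist_eq_norm] at this
    exact this.trans (by gcongr; exact le_max_left _ _)
  · rw [min_eq_right h, mul_one]
    have h3 := hM x
    have h4 := hM y
    rw [Real.norm_eq_abs] at h3 h4
    have := abs_sub (u x) (u y)
    exact le_max_of_le_right (by linarith)

/-- The radial function that dominates the Gagliardo integrand is integrable. -/
lemma integrable_kernel (hn : 0 < n) {s P a : ℝ} (hs : 0 < s) (hs1 : s < 1) (hP : 1 ≤ P)
    (ha : a * P = n + s * P) :
    Integrable (fun h : EuclideanSpace ℝ (Fin n) => (min ‖h‖ 1 / ‖h‖ ^ a) ^ P) volume := by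
  have : Nonempty (Fin n) := ⟨⟨0, hn⟩⟩
  rw [integrable_fun_norm_addHaar volume (f := fun t : ℝ => (min t 1 / t ^ a) ^ P)]
  have hd : Module.finrank ℝ (EuclideanSpace ℝ (Fin n)) = n := by simp
  rw [hd, ← Ioc_union_Ioi_eq_Ioi (zero_le_one (α := ℝ))]
  have hpow : ∀ t : ℝ, 0 < t → (t : ℝ) ^ (n - 1) = t ^ ((n : ℝ) - 1) := by
    intro t ht
    rw [← Real.rpow_natCast, Nat.cast_sub hn, Nat.cast_one]
  refine IntegrableOn.union ?_ ?_
  · have h1 : IntegrableOn (fun t : ℝ => t ^ (P - 1 - s * P)) (Ioc 0 1) := by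
      rw [← intervalIntegrable_iff_integrableOn_Ioc_of_le zero_le_one]
      refine intervalIntegral.intervalIntegrable_rpow' ?_
      nlinarith
    refine h1.congr_fun (fun t ht => ?_) measurableSet_Ioc
    have h0 : (0 : ℝ) < t := ht.1
    simp only [smul_eq_mul]
    rw [min_eq_left ht.2, hpow t h0, Real.div_rpow h0.le (by positivity), ← Real.rpow_mul h0.le,
      ha, ← Real.rpow_sub h0, ← Real.rpow_add h0]
    congr 1
    ring
  · have h1 : IntegrableOn (fun t : ℝ => t ^ (-1 - s * P)) (Ioi 1) := by
      refine integrableOn_Ioi_rpow_of_lt ?_ one_pos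
      nlinarith
    refine h1.congr_fun (fun t ht => ?_) measurableSet_Ioi
    have h0 : (0 : ℝ) < t := one_pos.trans ht
    simp only [smul_eq_mul]
    rw [min_eq_right (le_of_lt ht), hpow t h0, Real.div_rpow zero_le_one (by positivity),
      ← Real.rpow_mul h0.le, ha, Real.one_rpow, one_div, ← Real.rpow_neg h0.le,
      ← Real.rpow_add h0]
    congr 1
    ring

/-- The Gagliardo seminorm of a compactly supported `C^1` function is finite. -/
lemma C1c.memLp_diffQuot {u : EuclideanSpace ℝ (Fin n) → ℝ} (hu : u ∈ C1c n)
    (s : Set.Ioo (0 : ℝ) 1) {p : ℝ≥0∞} (hp : 1 ≤ p) :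
    MemLp (diffQuot n s p u) p
      ((volume : Measure (EuclideanSpace ℝ (Fin n))).prod volume) := by
  obtain ⟨s, hs, hs1⟩ := s
  obtain ⟨C, hC0, hC⟩ := C1c.exists_bound hu
  have hmeas := diffQuot_measurable s p hu.1.continuous
  rcases Nat.eq_zero_or_pos n with rfl | hn
  · have h0 : diffQuot 0 s p u = fun _ => 0 := by
      funext z
      simp [diffQuot, Subsingleton.elim z.1 z.2]
    simp only [h0]
    exact MemLp.zero'
  by_cases hpt : p = ∞
  · subst hpt
    refine memLp_top_of_bound hmeas.aestronglyMeasurable C (Filter.Eventually.of_forall ?_)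
    rintro ⟨x, y⟩
    simp only [diffQuot, ENNReal.toReal_top, div_zero, zero_add, Real.norm_eq_abs, abs_div]
    rw [abs_of_nonneg (by positivity : 0 ≤ ‖x - y‖ ^ s)]
    refine div_le_of_le_mul₀ (by positivity) hC0 ((hC x y).trans ?_)
    gcongr
    rcases le_total ‖x - y‖ 1 with h | h
    · rw [min_eq_left h]
      exact Real.self_le_rpow_of_le_one (norm_nonneg _) h hs1.le
    · rw [min_eq_right h]
      exact Real.one_le_rpow h hs.le
  have hp0 : p ≠ 0 := (zero_lt_one.trans_le hp).ne'
  have hP : 1 ≤ p.toReal := by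
    rw [← ENNReal.toReal_one]
    exact (ENNReal.toReal_le_toReal ENNReal.one_ne_top hpt).2 hp
  set P := p.toReal with hPdef
  set a : ℝ := (n : ℝ) / P + s with ha
  have haP : a * P = n + s * P := by
    rw [ha]
    field_simp
  have hker := (integrable_kernel hn hs hs1 hP haP).const_mul (C ^ P)
  set ψ : EuclideanSpace ℝ (Fin n) → ℝ :=
    fun h => C ^ P * (min ‖h‖ 1 / ‖h‖ ^ a) ^ P with hψ
  have hψ0 : ∀ h, 0 ≤ ψ h := fun h => by positivity
  have hK : MeasurableSet (tsupport u) := (isClosed_tsupport u).measurableSet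
  have hind : Integrable ((tsupport u).indicator (fun _ => (1 : ℝ))) volume :=
    (integrable_indicator_iff hK).2 (integrableOn_const hu.2.isCompact.measure_lt_top.ne)
  have hG1 := hind.convolution_integrand (ContinuousLinearMap.mul ℝ ℝ) hker
  have hG2 := hG1.swap
  rw [← integrable_norm_rpow_iff hmeas.aestronglyMeasurable hp0 hpt]
  refine (hG1.add hG2).mono' ?_ (Filter.Eventually.of_forall ?_)
  · exact (hmeas.norm.pow_const P).aestronglyMeasurable
  rintro ⟨x, y⟩
  have hind0 : ∀ w, 0 ≤ (tsupport u).indicator (fun _ => (1 : ℝ)) w :=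
    fun w => indicator_nonneg (fun _ _ => zero_le_one) w
  have hsymm : ψ (y - x) = ψ (x - y) := by simp only [hψ, norm_sub_rev]
  have hbd : ‖diffQuot n s p u (x, y)‖ ^ P ≤ ψ (x - y) := by
    simp only [hψ]
    rw [← Real.mul_rpow hC0 (by positivity)]
    simp only [diffQuot, Real.norm_eq_abs, abs_div]
    rw [abs_of_nonneg (by positivity : 0 ≤ ‖x - y‖ ^ ((n : ℝ) / p.toReal + s)), mul_div_assoc']
    gcongr
    exact hC x y
  rw [Real.norm_of_nonneg (by positivity)]
  change _ ≤ (tsupport u).indicator (fun _ => (1 : ℝ)) y * ψ (x - y) +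
    (tsupport u).indicator (fun _ => (1 : ℝ)) x * ψ (y - x)
  rw [hsymm]
  by_cases hy : y ∈ tsupport u
  · rw [indicator_of_mem hy, one_mul]
    exact hbd.trans (le_add_of_nonneg_right (mul_nonneg (hind0 x) (hψ0 _)))
  by_cases hx : x ∈ tsupport u
  · rw [indicator_of_mem hx, one_mul]
    exact hbd.trans (le_add_of_nonneg_left (mul_nonneg (hind0 y) (hψ0 _)))
  have hz : diffQuot n s p u (x, y) = 0 := by
    simp [diffQuot, image_eq_zero_of_notMem_tsupport hx, image_eq_zero_of_notMem_tsupport hy]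
  rw [hz, norm_zero, Real.zero_rpow (by positivity)]
  exact add_nonneg (mul_nonneg (hind0 y) (hψ0 _)) (mul_nonneg (hind0 x) (hψ0 _))

lemma C1c.memLp {u : EuclideanSpace ℝ (Fin n) → ℝ} (hu : u ∈ C1c n) (q : ℝ≥0∞) :
    MemLp u q volume :=
  hu.1.continuous.memLp_of_hasCompactSupport hu.2

variable {s : Set.Ioo (0 : ℝ) 1} {q p : ℝ≥0∞}

instance : AddCommGroup (Pre n s q p) := inferInstanceAs (AddCommGroup (C1c n))

instance : Module ℝ (Pre n s q p) := inferInstanceAs (Module ℝ (C1c n))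

/-- The function underlying an element of `Pre n s q p`. -/
def Pre.toFun (u : Pre n s q p) : EuclideanSpace ℝ (Fin n) → ℝ := u.1

/-- The norm `‖u‖_q + [u]_{s,p}`. -/
instance : Norm (Pre n s q p) where
  norm u := (eLpNorm u.toFun q volume).toReal + (gagliardo n s p u.toFun).toReal

lemma Pre.core [hq : Fact (1 ≤ q)] [hp : Fact (1 ≤ p)] :
    NormedSpace.Core ℝ (Pre n s q p) where
  norm_nonneg _ := add_nonneg ENNReal.toReal_nonneg ENNReal.toReal_nonneg
  norm_smul c u := by
    change (eLpNorm (c • u.toFun) q volume).toReal + (gagliardo n s p (c • u.toFun)).toReal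
      = ‖c‖ * ((eLpNorm u.toFun q volume).toReal + (gagliardo n s p u.toFun).toReal)
    unfold gagliardo
    rw [diffQuot_smul, eLpNorm_const_smul, eLpNorm_const_smul, ENNReal.toReal_mul,
      ENNReal.toReal_mul, toReal_enorm, mul_add]
  norm_triangle u v := by
    change (eLpNorm (u.toFun + v.toFun) q volume).toReal +
        (gagliardo n s p (u.toFun + v.toFun)).toReal
      ≤ ((eLpNorm u.toFun q volume).toReal + (gagliardo n s p u.toFun).toReal) +
        ((eLpNorm v.toFun q volume).toReal + (gagliardo n s p v.toFun).toReal)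
    unfold gagliardo
    have hu := C1c.memLp u.2 q
    have hv := C1c.memLp v.2 q
    have hu' := C1c.memLp_diffQuot u.2 s hp.out
    have hv' := C1c.memLp_diffQuot v.2 s hp.out
    have h1 := ENNReal.toReal_mono (ENNReal.add_ne_top.2 ⟨hu.2.ne, hv.2.ne⟩)
      (eLpNorm_add_le hu.1 hv.1 hq.out)
    have h2 := ENNReal.toReal_mono (ENNReal.add_ne_top.2 ⟨hu'.2.ne, hv'.2.ne⟩)
      (eLpNorm_add_le hu'.1 hv'.1 hp.out)
    rw [ENNReal.toReal_add hu.2.ne hv.2.ne] at h1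
    rw [ENNReal.toReal_add hu'.2.ne hv'.2.ne] at h2
    rw [diffQuot_add]
    exact (add_le_add h1 h2).trans_eq (add_add_add_comm _ _ _ _)
  norm_eq_zero_iff u := by
    constructor
    · intro h
      change (eLpNorm u.toFun q volume).toReal + (gagliardo n s p u.toFun).toReal = 0 at h
      have hu : MemLp u.toFun q volume := C1c.memLp u.2 q
      have h1 : (eLpNorm u.toFun q volume).toReal = 0 := by
        have h2 : 0 ≤ (eLpNorm u.toFun q volume).toReal := ENNReal.toReal_nonneg
        have h3 : 0 ≤ (gagliardo n s p u.toFun).toReal := ENNReal.toReal_nonneg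
        linarith
      have h2 : eLpNorm u.toFun q volume = 0 :=
        ((ENNReal.toReal_eq_zero_iff _).1 h1).resolve_right hu.2.ne
      rw [eLpNorm_eq_zero_iff hu.1 (zero_lt_one.trans_le hq.out).ne'] at h2
      exact Subtype.ext ((u.2.1.continuous.ae_eq_iff_eq volume continuous_const).1 h2)
    · rintro rfl
      have h0 : (0 : Pre n s q p).toFun = 0 := rfl
      have h1 : diffQuot n s p (0 : EuclideanSpace ℝ (Fin n) → ℝ) = 0 := by
        funext z
        simp [diffQuot]
      change (eLpNorm _ q volume).toReal + (gagliardo n s p _).toReal = 0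
      simp [h0, gagliardo, h1]

instance [Fact (1 ≤ q)] [Fact (1 ≤ p)] : NormedAddCommGroup (Pre n s q p) :=
  NormedAddCommGroup.ofCore Pre.core

instance [Fact (1 ≤ q)] [Fact (1 ≤ p)] : NormedSpace ℝ (Pre n s q p) :=
  NormedSpace.ofCore Pre.core

/-- The Banach space `M^{s;q,p}(ℝⁿ)`: the completion of `C^1_c(ℝⁿ)` with respect to the norm
`‖u‖_q + [u]_{s,p}`. -/
abbrev M (n : ℕ) (s : Set.Ioo (0 : ℝ) 1) (q p : ℝ≥0∞) [Fact (1 ≤ q)] [Fact (1 ≤ p)] : Type :=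
  UniformSpace.Completion (Pre n s q p)

/-- `M^{s;q,p}(ℝⁿ)` embeds continuously into `L^r(ℝⁿ)`: there is an injective continuous linear map
(the embedding `ι`) which sends each `u` in `C^1_c(ℝⁿ)` to its class in `L^r(ℝⁿ)`. -/
def EmbedsInLp (n : ℕ) (s : Set.Ioo (0 : ℝ) 1) (q p r : ℝ≥0∞)
    [Fact (1 ≤ q)] [Fact (1 ≤ p)] [Fact (1 ≤ r)] : Prop :=
  ∃ ι : M n s q p →L[ℝ] Lp ℝ r (volume : Measure (EuclideanSpace ℝ (Fin n))),
    Function.Injective ι ∧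
    ∀ u : Pre n s q p, ι (u : M n s q p) =ᵐ[volume] u.toFun

/-- The critical exponent `n p / (n - s p)`; only used for `s p < n`. -/
def critExp (n : ℕ) (s : Set.Ioo (0 : ℝ) 1) (p : ℝ≥0∞) : ℝ≥0∞ :=
  (n * p) / (n - ENNReal.ofReal s * p)

end FracSobolev

end

noncomputable section

open Filter Topology UniformSpace

namespace FracSobolev

/-! ### Completion, injectivity, and reduction to an a priori bound -/

section Embedding

variable {n : ℕ} {s : Set.Ioo (0 : ℝ) 1} {q p r : ℝ≥0∞}

/-! An estimate of the `L^r` norm by the `M` norm on `C^1_c` extends to the completion; the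
extension is injective because the limits in `L^q`, in `L^r` and of the difference quotients are all
limits in measure of one sequence. So if the `L^r` limit vanishes, so do the other two, and with
them the norm (`embedsInLp_of_norm_le`).

The estimates for `sp ≤ n` rest on one pointwise bound (`rpow_enorm_le_lintegral_diffQuot`). By
Chebyshev, `{|u| ≥ |u x| / 2}` fills at most half of a suitable ball about `x`, and on the rest of
the ball `|u x - u y| ≥ |u x| / 2`. With `σ = sp/n`, integrating in `x` gives `∫ |u|^(p + tσ) ≤ C (∫
|u|^t)^σ` whenever `[u] ≤ 1`. For `σ < 1` the exponent `t = p*` is fixed by `t ↦ p + tσ`, and the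
right side is absorbed. For `σ = 1` each use raises the exponent by `p`, so iteration from `q`
reaches every finite exponent.

For `sp > n`, comparing `u x - u y` with a good pair of nearby points halves the Hölder constant up
to an additive constant (`exists_half_holder`). Iteration gives a Morrey bound, and the `L^q` norm
then controls the supremum. Interpolation supplies the intermediate `r`. -/

lemma Pre.norm_def (u : Pre n s q p) :
    ‖u‖ = (eLpNorm u.toFun q volume).toReal + (gagliardo n s p u.toFun).toReal := rfl

lemma Pre.memLp (u : Pre n s q p) (r : ℝ≥0∞) : MemLp u.toFun r volume := C1c.memLp u.2 r

lemma Pre.memLp_diffQuot [Fact (1 ≤ p)] (u : Pre n s q p) :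
    MemLp (diffQuot n s p u.toFun) p
      ((volume : Measure (EuclideanSpace ℝ (Fin n))).prod volume) :=
  C1c.memLp_diffQuot u.2 s Fact.out

/-- The class in `L^r` of a compactly supported `C^1` function. -/
def Pre.toLp (n : ℕ) (s : Set.Ioo (0 : ℝ) 1) (q p r : ℝ≥0∞) :
    Pre n s q p →ₗ[ℝ] Lp ℝ r (volume : Measure (EuclideanSpace ℝ (Fin n))) where
  toFun u := (u.memLp r).toLp u.toFun
  map_add' _ _ := rfl
  map_smul' _ _ := rfl

/-- The class in `L^p(ℝⁿ × ℝⁿ)` of the difference quotient. -/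
def Pre.diffLp (n : ℕ) (s : Set.Ioo (0 : ℝ) 1) (q p : ℝ≥0∞) [Fact (1 ≤ p)] :
    Pre n s q p →ₗ[ℝ]
      Lp ℝ p ((volume : Measure (EuclideanSpace ℝ (Fin n))).prod
        (volume : Measure (EuclideanSpace ℝ (Fin n)))) where
  toFun u := u.memLp_diffQuot.toLp (diffQuot n s p u.toFun)
  map_add' u v := by
    exact MemLp.toLp_congr (u + v).memLp_diffQuot (u.memLp_diffQuot.add v.memLp_diffQuot) (.of_eq (diffQuot_add s p u.toFun v.toFun))
  map_smul' c u := by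
    exact MemLp.toLp_congr (c • u).memLp_diffQuot (u.memLp_diffQuot.const_smul c) (.of_eq (diffQuot_smul s p c u.toFun))

lemma Pre.norm_toLp (u : Pre n s q p) :
    ‖Pre.toLp n s q p r u‖ = (eLpNorm u.toFun r volume).toReal :=
  Lp.norm_toLp _ (u.memLp r)

lemma Pre.norm_diffLp [Fact (1 ≤ p)] (u : Pre n s q p) :
    ‖Pre.diffLp n s q p u‖ = (gagliardo n s p u.toFun).toReal :=
  Lp.norm_toLp _ u.memLp_diffQuot

lemma Pre.coeFn_toLp (u : Pre n s q p) : Pre.toLp n s q p r u =ᵐ[volume] u.toFun :=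
  MemLp.coeFn_toLp (u.memLp r)

lemma Pre.coeFn_diffLp [Fact (1 ≤ p)] (u : Pre n s q p) :
    Pre.diffLp n s q p u =ᵐ[(volume : Measure (EuclideanSpace ℝ (Fin n))).prod
      volume] diffQuot n s p u.toFun :=
  MemLp.coeFn_toLp u.memLp_diffQuot

variable [Fact (1 ≤ q)] [Fact (1 ≤ p)]

/-- The extension of `Pre.toLp` with values in `L^q` to the completion. -/
def M.toLp (n : ℕ) (s : Set.Ioo (0 : ℝ) 1) (q p : ℝ≥0∞) [Fact (1 ≤ q)] [Fact (1 ≤ p)] :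
    M n s q p →L[ℝ] Lp ℝ q (volume : Measure (EuclideanSpace ℝ (Fin n))) :=
  ((Pre.toLp n s q p q).mkContinuous 1 fun u => by
    rw [Pre.norm_toLp, Pre.norm_def, one_mul]
    exact le_add_of_nonneg_right ENNReal.toReal_nonneg).fromCompletion

/-- The extension of `Pre.diffLp` to the completion. -/
def M.diffLp (n : ℕ) (s : Set.Ioo (0 : ℝ) 1) (q p : ℝ≥0∞) [Fact (1 ≤ q)] [Fact (1 ≤ p)] :
    M n s q p →L[ℝ] Lp ℝ p ((volume : Measure (EuclideanSpace ℝ (Fin n))).prod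
        (volume : Measure (EuclideanSpace ℝ (Fin n)))) :=
  ((Pre.diffLp n s q p).mkContinuous 1 fun u => by
    rw [Pre.norm_diffLp, Pre.norm_def, one_mul]
    exact le_add_of_nonneg_left ENNReal.toReal_nonneg).fromCompletion

lemma M.toLp_coe (u : Pre n s q p) : M.toLp n s q p u = Pre.toLp n s q p q u :=
  ContinuousLinearMap.fromCompletion_apply_coe _ _

lemma M.diffLp_coe (u : Pre n s q p) : M.diffLp n s q p u = Pre.diffLp n s q p u :=
  ContinuousLinearMap.fromCompletion_apply_coe _ _

/-- Both sides are continuous and agree on a dense set. Hence an element of the completion vanishes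
once its two limits do. -/
lemma M.norm_eq (x : M n s q p) : ‖x‖ = ‖M.toLp n s q p x‖ + ‖M.diffLp n s q p x‖ := by
  induction x using Completion.induction_on with
  | hp => exact isClosed_eq continuous_norm ((M.toLp n s q p).continuous.norm.add
      (M.diffLp n s q p).continuous.norm)
  | ih u =>
    rw [M.toLp_coe, M.diffLp_coe, Pre.norm_toLp, Pre.norm_diffLp, Completion.norm_coe,
      Pre.norm_def]

lemma M.exists_seq_tendsto (x : M n s q p) :
    ∃ u : ℕ → Pre n s q p, Tendsto (fun k => (u k : M n s q p)) atTop (𝓝 x) := by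
  obtain ⟨v, hv, hvx⟩ := mem_closure_iff_seq_limit.1 (Completion.denseRange_coe x)
  choose u hu using hv
  exact ⟨u, by simpa only [hu] using hvx⟩

/-- Convergence in measure has a.e. unique limits and is implied by convergence in any `L^r`, so it
allows limits for different exponents to be compared. -/
lemma M.tendstoInMeasure [Fact (1 ≤ r)]
    {ι : M n s q p →L[ℝ] Lp ℝ r (volume : Measure (EuclideanSpace ℝ (Fin n)))}
    (hι : ∀ u : Pre n s q p, ι (u : M n s q p) =ᵐ[volume] u.toFun)
    {u : ℕ → Pre n s q p} {x : M n s q p}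
    (hu : Tendsto (fun k => (u k : M n s q p)) atTop (𝓝 x)) :
    TendstoInMeasure volume (fun k => (u k).toFun) atTop (ι x) :=
  (tendstoInMeasure_of_tendsto_Lp ((ι.continuous.tendsto x).comp hu)).congr_left
    fun k => hι (u k)

lemma M.coeFn_toLp (u : Pre n s q p) : M.toLp n s q p u =ᵐ[volume] u.toFun := by
  rw [M.toLp_coe]
  exact Pre.coeFn_toLp u

/-- On the completion, the limiting difference quotient is that of the limiting function. -/
lemma M.coeFn_diffLp (x : M n s q p) :
    M.diffLp n s q p x =ᵐ[(volume : Measure (EuclideanSpace ℝ (Fin n))).prod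
      volume] diffQuot n s p (M.toLp n s q p x) := by
  obtain ⟨u, hu⟩ := M.exists_seq_tendsto x
  obtain ⟨a, ha, hae⟩ := (M.tendstoInMeasure M.coeFn_toLp hu).exists_seq_tendsto_ae
  have h1 : TendstoInMeasure (volume.prod volume) (fun k => diffQuot n s p (u (a k)).toFun) atTop
      (M.diffLp n s q p x) := by
    refine (tendstoInMeasure_of_tendsto_Lp (((M.diffLp n s q p).continuous.tendsto x).comp
      (hu.comp ha.tendsto_atTop))).congr_left fun k => ?_
    simp only [Function.comp_apply, M.diffLp_coe]
    exact Pre.coeFn_diffLp _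
  obtain ⟨b, hb, hbe⟩ := h1.exists_seq_tendsto_ae
  -- The coordinate projections pull null sets back to null sets, so a.e. convergence of `u` on `ℝⁿ`
  -- holds in both variables for a.e. pair.
  filter_upwards [hbe, Measure.quasiMeasurePreserving_fst.ae hae,
    Measure.quasiMeasurePreserving_snd.ae hae] with z hz h1 h2
  refine tendsto_nhds_unique hz ?_
  exact (((h1.comp hb.tendsto_atTop).sub (h2.comp hb.tendsto_atTop)).div_const _)

lemma embedsInLp_of_norm_le [Fact (1 ≤ r)] {K : ℝ}
    (hK : ∀ u : Pre n s q p, (eLpNorm u.toFun r volume).toReal ≤ K * ‖u‖) :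
    EmbedsInLp n s q p r := by
  let ι : M n s q p →L[ℝ] Lp ℝ r (volume : Measure (EuclideanSpace ℝ (Fin n))) :=
    ((Pre.toLp n s q p r).mkContinuous K fun u => by
      rw [Pre.norm_toLp]
      exact hK u).fromCompletion
  have hι : ∀ u : Pre n s q p, ι (u : M n s q p) =ᵐ[volume] u.toFun := fun u => by
    rw [show ι (u : M n s q p) = Pre.toLp n s q p r u from
      ContinuousLinearMap.fromCompletion_apply_coe _ _]
    exact Pre.coeFn_toLp u
  refine ⟨ι, (injective_iff_map_eq_zero ι).2 fun x hx => ?_, hι⟩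
  obtain ⟨u, hu⟩ := M.exists_seq_tendsto x
  have h1 : M.toLp n s q p x =ᵐ[volume] 0 := by
    -- The `L^q` limit and the `L^r` limit of the same sequence coincide a.e.
    have h := tendstoInMeasure_ae_unique (M.tendstoInMeasure M.coeFn_toLp hu)
      (M.tendstoInMeasure hι hu)
    rw [hx] at h
    exact h.trans (Lp.coeFn_zero _ _ _)
  have h2 : M.diffLp n s q p x =ᵐ[volume.prod volume] 0 := by
    filter_upwards [M.coeFn_diffLp x, Measure.quasiMeasurePreserving_fst.ae h1,
      Measure.quasiMeasurePreserving_snd.ae h1] with z hz h1 h2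
    rw [hz, diffQuot, h1, h2]
    simp
  rw [← norm_eq_zero, M.norm_eq, (Lp.eq_zero_iff_ae_eq_zero).2 h1, (Lp.eq_zero_iff_ae_eq_zero).2 h2]
  simp

/-- By homogeneity, it suffices to bound the `L^r` norm on the unit ball. -/
lemma embedsInLp_of_eLpNorm_le [Fact (1 ≤ r)] {K : ℝ≥0∞} (hK : K ≠ ∞)
    (h : ∀ u ∈ C1c n, eLpNorm u q volume ≤ 1 → gagliardo n s p u ≤ 1 → eLpNorm u r volume ≤ K) :
    EmbedsInLp n s q p r := by
  refine embedsInLp_of_norm_le (K := K.toReal) fun u => ?_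
  rcases eq_or_ne u 0 with rfl | hu
  · simp [show (0 : Pre n s q p).toFun = 0 from rfl]
  have hN : 0 < ‖u‖ := norm_pos_iff.2 hu
  set v : Pre n s q p := ‖u‖⁻¹ • u with hv
  have hv1 : ‖v‖ = 1 := by rw [hv, norm_smul, norm_inv, norm_norm, inv_mul_cancel₀ hN.ne']
  have hfin1 : eLpNorm v.toFun q volume ≠ ∞ := (v.memLp q).2.ne
  have hfin2 : gagliardo n s p v.toFun ≠ ∞ := v.memLp_diffQuot.2.ne
  rw [Pre.norm_def] at hv1
  have h3 := h v.toFun v.2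
    (by rw [← ENNReal.toReal_le_toReal hfin1 ENNReal.one_ne_top, ENNReal.toReal_one]
        linarith [ENNReal.toReal_nonneg (a := gagliardo n s p v.toFun)])
    (by rw [← ENNReal.toReal_le_toReal hfin2 ENNReal.one_ne_top, ENNReal.toReal_one]
        linarith [ENNReal.toReal_nonneg (a := eLpNorm v.toFun q volume)])
  have h4 := ENNReal.toReal_mono hK h3
  rw [show v.toFun = ‖u‖⁻¹ • u.toFun from rfl, eLpNorm_const_smul, ENNReal.toReal_mul,
    toReal_enorm, norm_inv, norm_norm] at h4
  rwa [inv_mul_le_iff₀ hN, mul_comm] at h4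

end Embedding

/-! ### Interpolation and mean values in `L^p` -/

section Lp

variable {α F : Type*} {mα : MeasurableSpace α} {μ : Measure α} [NormedAddCommGroup F]

lemma lintegral_enorm_rpow_toReal (f : α → F) {p : ℝ≥0∞} (h0 : p ≠ 0) (hp : p ≠ ∞) :
    ∫⁻ x, ‖f x‖ₑ ^ p.toReal ∂μ = eLpNorm f p μ ^ p.toReal := by
  rw [eLpNorm_eq_eLpNorm' h0 hp]
  exact lintegral_rpow_enorm_eq_rpow_eLpNorm' (ENNReal.toReal_pos h0 hp)

/-- A bound in `L^a` and in `L^b` gives a bound in `L^r` for `a ≤ r ≤ b`. -/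
lemma exists_eLpNorm_le_of_le_of_le {a b r K : ℝ≥0∞} (ha : a ≠ 0) (har : a ≤ r) (hrb : r ≤ b)
    (hK : K ≠ ∞) :
    ∃ K' : ℝ≥0∞, K' ≠ ∞ ∧ ∀ f : α → F, AEStronglyMeasurable f μ →
      eLpNorm f a μ ≤ K → eLpNorm f b μ ≤ K → eLpNorm f r μ ≤ K' := by
  rcases eq_or_ne r ∞ with rfl | hr
  · exact ⟨K, hK, fun f _ _ h => top_le_iff.1 hrb ▸ h⟩
  have hr0 : r ≠ 0 := (pos_of_ne_zero ha |>.trans_le har).ne'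
  have hat : a ≠ ∞ := (har.trans_lt hr.lt_top).ne
  have hA : 0 < a.toReal := ENNReal.toReal_pos ha hat
  have hR : 0 < r.toReal := ENNReal.toReal_pos hr0 hr
  have hAR : a.toReal ≤ r.toReal := ENNReal.toReal_mono hr har
  suffices h : ∃ L : ℝ≥0∞, L ≠ ∞ ∧ ∀ f : α → F, AEStronglyMeasurable f μ →
      eLpNorm f a μ ≤ K → eLpNorm f b μ ≤ K → ∫⁻ x, ‖f x‖ₑ ^ r.toReal ∂μ ≤ L by
    obtain ⟨L, hL, h⟩ := h
    refine ⟨L ^ (1 / r.toReal), ENNReal.rpow_ne_top_of_nonneg (by positivity) hL,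
      fun f hf h1 h2 => ?_⟩
    rw [eLpNorm_eq_lintegral_rpow_enorm_toReal hr0 hr]
    exact ENNReal.rpow_le_rpow (h f hf h1 h2) (by positivity)
  rcases eq_or_ne b ∞ with rfl | hb
  -- For `b = ∞`, `|f| ≤ K` a.e., so `|f|^r ≤ K^(r-a) |f|^a`.
  · refine ⟨K ^ (r.toReal - a.toReal) * K ^ a.toReal, ENNReal.mul_ne_top
      (ENNReal.rpow_ne_top_of_nonneg (by linarith) hK)
      (ENNReal.rpow_ne_top_of_nonneg hA.le hK), fun f hf h1 h2 => ?_⟩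
    calc ∫⁻ x, ‖f x‖ₑ ^ r.toReal ∂μ
        ≤ ∫⁻ x, K ^ (r.toReal - a.toReal) * ‖f x‖ₑ ^ a.toReal ∂μ := by
          refine lintegral_mono_ae ?_
          rw [eLpNorm_exponent_top] at h2
          filter_upwards [enorm_ae_le_eLpNormEssSup f μ] with x hx
          calc ‖f x‖ₑ ^ r.toReal = ‖f x‖ₑ ^ (r.toReal - a.toReal) * ‖f x‖ₑ ^ a.toReal := by
                rw [← ENNReal.rpow_add_of_nonneg _ _ (by linarith) hA.le, sub_add_cancel]
            _ ≤ _ := by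
                gcongr
                exact hx.trans h2
      _ = K ^ (r.toReal - a.toReal) * eLpNorm f a μ ^ a.toReal := by
          rw [lintegral_const_mul' _ _ (ENNReal.rpow_ne_top_of_nonneg (by linarith) hK),
            lintegral_enorm_rpow_toReal f ha hat]
      _ ≤ _ := by gcongr
  · have hb0 : b ≠ 0 := (pos_of_ne_zero hr0 |>.trans_le hrb).ne'
    have hRB : r.toReal ≤ b.toReal := ENNReal.toReal_mono hb hrb
    refine ⟨K ^ a.toReal + K ^ b.toReal, ENNReal.add_ne_top.2
      ⟨ENNReal.rpow_ne_top_of_nonneg hA.le hK,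
        ENNReal.rpow_ne_top_of_nonneg (by positivity) hK⟩, fun f hf h1 h2 => ?_⟩
    calc ∫⁻ x, ‖f x‖ₑ ^ r.toReal ∂μ
        ≤ ∫⁻ x, (‖f x‖ₑ ^ a.toReal + ‖f x‖ₑ ^ b.toReal) ∂μ := by
          -- Where `|f| ≤ 1` the smaller exponent dominates, elsewhere the larger one.
          refine lintegral_mono fun x => ?_
          rcases le_total ‖f x‖ₑ 1 with hx | hx
          · exact (ENNReal.rpow_le_rpow_of_exponent_ge hx hAR).trans le_self_add
          · exact (ENNReal.rpow_le_rpow_of_exponent_le hx hRB).trans le_add_self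
      _ = eLpNorm f a μ ^ a.toReal + eLpNorm f b μ ^ b.toReal := by
          rw [lintegral_add_left' (hf.enorm.pow_const _), lintegral_enorm_rpow_toReal f ha hat,
            lintegral_enorm_rpow_toReal f hb0 hb]
      _ ≤ _ := by gcongr

/-- On a set of positive finite measure, a function is somewhere not larger than its `L^p` mean. -/
lemma exists_mem_norm_mul_measure_rpow_lt {f : α → F} {p : ℝ≥0∞} (hp : p ≠ 0) {A : Set α}
    (hA : MeasurableSet A) (h0 : μ A ≠ 0) (h1 : μ A ≠ ∞) {N : ℝ} (hN0 : 0 < N)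
    (hN : eLpNorm f p μ < ENNReal.ofReal N) :
    ∃ x ∈ A, ‖f x‖ * (μ A).toReal ^ (1 / p.toReal) < N := by
  -- Otherwise `|f|` dominates the constant `N / v` on `A`, whose `L^p` norm is exactly `N`. For `p
  -- = ∞` the exponent `1 / p.toReal` is `0`, and `μ A ≠ 0` keeps this true.
  by_contra! h
  have hv : 0 < (μ A).toReal := ENNReal.toReal_pos h0 h1
  set v := (μ A).toReal ^ (1 / p.toReal) with hv'
  have hv0 : 0 < v := by positivity
  refine hN.not_ge ?_
  calc ENNReal.ofReal N = ‖N / v‖ₑ * μ A ^ (1 / p.toReal) := by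
        rw [← ENNReal.ofReal_toReal h1, ENNReal.ofReal_rpow_of_pos hv,
          Real.enorm_of_nonneg (by positivity), ← ENNReal.ofReal_mul (by positivity), ← hv',
          div_mul_cancel₀ _ hv0.ne']
    _ = eLpNorm (A.indicator fun _ => N / v) p μ := (eLpNorm_indicator_const' hA h0 hp).symm
    _ ≤ eLpNorm f p μ := by
        refine eLpNorm_mono fun x => ?_
        by_cases hx : x ∈ A
        · rw [indicator_of_mem hx, Real.norm_of_nonneg (by positivity), div_le_iff₀ hv0]
          exact h x hx
        · simp [indicator_of_notMem hx]

end Lp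

/-! ### Subcritical and critical cases: `sp ≤ n` -/

lemma rpow_enorm_le_lintegral_diffQuot {n : ℕ} (hn : 0 < n) {s t : ℝ} (hs : 0 < s) (ht : 0 < t)
    {p : ℝ≥0∞} (hp0 : p ≠ 0) (hp : p ≠ ∞) :
    ∃ C : ℝ≥0, ∀ u : EuclideanSpace ℝ (Fin n) → ℝ, Continuous u →
      ∫⁻ y, ‖u y‖ₑ ^ t ≠ ∞ → ∀ x,
      ‖u x‖ₑ ^ (p.toReal + t * (s * p.toReal / n)) ≤
        C * (∫⁻ y, ‖u y‖ₑ ^ t) ^ (s * p.toReal / n) *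
          ∫⁻ y, ‖diffQuot n s p u (x, y)‖ₑ ^ p.toReal := by
  have hP : 0 < p.toReal := ENNReal.toReal_pos hp0 hp
  set P := p.toReal with hPdef
  have hn' : (0 : ℝ) < n := Nat.cast_pos.2 hn
  set σ : ℝ := s * P / n with hσ
  have hσ0 : 0 < σ := by positivity
  have : Nonempty (Fin n) := ⟨⟨0, hn⟩⟩
  set ω : ℝ := (volume (Metric.ball (0 : EuclideanSpace ℝ (Fin n)) 1)).toReal with hω
  have hω0 : 0 < ω := ENNReal.toReal_pos (Metric.measure_ball_pos _ _ one_pos).ne'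
    measure_ball_lt_top.ne
  have hωe : volume (Metric.ball (0 : EuclideanSpace ℝ (Fin n)) 1) = ENNReal.ofReal ω :=
    (ENNReal.ofReal_toReal measure_ball_lt_top.ne).symm
  -- The factor `2 ^ (P + tσ)` comes from `|u x| = 2b`, and `(2 / ω) ^ (1 + σ)` from the radius `R`,
  -- for which `R^(n + sP) = (2m / ω)^(1 + σ)`.
  refine ⟨(2 ^ (P + t * σ) * (2 / ω) ^ (1 + σ) : ℝ).toNNReal, fun u hu hI x => ?_⟩
  rcases eq_or_ne (u x) 0 with hx | hx
  · rw [hx, enorm_zero, ENNReal.zero_rpow_of_pos (by positivity)]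
    exact zero_le
  set I := ∫⁻ y, ‖u y‖ₑ ^ t with hIdef
  have hI0 : I ≠ 0 := by
    intro h
    rw [hIdef, lintegral_eq_zero_iff (by fun_prop)] at h
    have h1 : u =ᵐ[volume] fun _ => 0 := by
      filter_upwards [h] with y hy
      simpa [ht, ht.not_gt] using hy
    exact hx (congrFun ((hu.ae_eq_iff_eq volume continuous_const).1 h1) x)
  have hIr : 0 < I.toReal := ENNReal.toReal_pos hI0 hI
  have hIe : I = ENNReal.ofReal I.toReal := (ENNReal.ofReal_toReal hI).symm
  set J := I.toReal with hJ
  set b : ℝ := |u x| / 2 with hb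
  have hb0 : 0 < b := by positivity
  -- `m` is the Chebyshev bound for the measure of `{|u| ≥ b}`; `R` is chosen so that the ball has
  -- measure `2m`.
  set m : ℝ := J / b ^ t with hm
  have hm0 : 0 < m := by positivity
  set R : ℝ := (2 * m / ω) ^ (1 / (n : ℝ)) with hR
  have hR0 : 0 < R := by positivity
  set e : ℝ := (n : ℝ) / P + s with he
  have hRe : (R ^ e) ^ P = (2 * m / ω) ^ (1 + σ) := by
    rw [hR, ← Real.rpow_mul (by positivity), ← Real.rpow_mul (by positivity)]
    congr 1
    rw [he, hσ]
    field_simp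
  set A : Set (EuclideanSpace ℝ (Fin n)) := {y | ENNReal.ofReal (b ^ t) ≤ ‖u y‖ₑ ^ t} with hAdef
  have hAm : MeasurableSet A := measurableSet_le (by fun_prop) (by fun_prop)
  have hA : volume A ≤ ENNReal.ofReal m := by
    have h := mul_meas_ge_le_lintegral (μ := volume) (f := fun y => ‖u y‖ₑ ^ t) (by fun_prop)
      (ENNReal.ofReal (b ^ t))
    rw [hm, ENNReal.ofReal_div_of_pos (by positivity), ← hIe]
    rw [ENNReal.le_div_iff_mul_le (.inl (by positivity)) (.inl ENNReal.ofReal_ne_top), mul_comm]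
    exact h
  have hB : volume (Metric.ball x R) = ENNReal.ofReal (2 * m) := by
    rw [Measure.addHaar_ball_of_pos _ _ hR0, hωe, ← ENNReal.ofReal_mul (by positivity),
      finrank_euclideanSpace, Fintype.card_fin, hR, one_div,
      Real.rpow_inv_natCast_pow (by positivity) hn.ne']
    congr 1
    field_simp
  have hE : ENNReal.ofReal m ≤ volume (Metric.ball x R \ A) := by
    refine le_trans ?_ le_measure_sdiff
    rw [hB]
    refine le_trans ?_ (tsub_le_tsub_left hA _)
    rw [← ENNReal.ofReal_sub _ hm0.le]
    exact ENNReal.ofReal_le_ofReal (by linarith)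
  have hpt : ∀ y ∈ Metric.ball x R \ A,
      ENNReal.ofReal ((b / R ^ e) ^ P) ≤ ‖diffQuot n s p u (x, y)‖ₑ ^ P := by
    rintro y ⟨hy, hyA⟩
    have h1 : |u y| < b := by
      by_contra! h
      refine hyA ?_
      rw [hAdef, mem_ofPred_eq]
      rw [Real.enorm_eq_ofReal_abs, ENNReal.ofReal_rpow_of_nonneg (abs_nonneg _) ht.le]
      exact ENNReal.ofReal_le_ofReal (Real.rpow_le_rpow hb0.le h ht.le)
    have h2 : b ≤ |u x - u y| := by
      have := abs_sub_abs_le_abs_sub (u x) (u y)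
      have : |u x| = 2 * b := by rw [hb]; ring
      linarith
    have h3 : 0 < ‖x - y‖ := by
      rw [norm_sub_pos_iff]
      rintro rfl
      simp at h2
      linarith
    have h4 : ‖x - y‖ ≤ R := by
      rw [Metric.mem_ball', dist_eq_norm] at hy
      exact hy.le
    rw [Real.enorm_eq_ofReal_abs, ENNReal.ofReal_rpow_of_nonneg (abs_nonneg _) hP.le]
    refine ENNReal.ofReal_le_ofReal (Real.rpow_le_rpow (by positivity) ?_ hP.le)
    rw [diffQuot, abs_div, abs_of_pos (by positivity : 0 < ‖x - y‖ ^ ((n : ℝ) / p.toReal + s))]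
    change b / R ^ e ≤ |u x - u y| / ‖x - y‖ ^ e
    have he0 : 0 ≤ e := by positivity
    gcongr
  have hint : ENNReal.ofReal ((b / R ^ e) ^ P * m) ≤
      ∫⁻ y, ‖diffQuot n s p u (x, y)‖ₑ ^ P := by
    have hmeas : Measurable fun y => ‖diffQuot n s p u (x, y)‖ₑ ^ P :=
      ((diffQuot_measurable s p hu).comp measurable_prodMk_left).enorm.pow_const _
    calc _ = ENNReal.ofReal ((b / R ^ e) ^ P) * ENNReal.ofReal m :=
          ENNReal.ofReal_mul (by positivity)
      _ ≤ ENNReal.ofReal ((b / R ^ e) ^ P) * volume (Metric.ball x R \ A) := by gcongr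
      _ = ∫⁻ y in Metric.ball x R \ A, ENNReal.ofReal ((b / R ^ e) ^ P) :=
          (setLIntegral_const _ _).symm
      _ ≤ ∫⁻ y in Metric.ball x R \ A, ‖diffQuot n s p u (x, y)‖ₑ ^ P :=
          setLIntegral_mono hmeas hpt
      _ ≤ _ := setLIntegral_le_lintegral _ _
  -- With `m = J / b^t` the constant makes this an exact identity: the powers of `J` cancel and
  -- `b^(P + tσ)` remains.
  refine le_trans (le_of_eq ?_) (mul_le_mul_right hint _)
  rw [hIe, ENNReal.ofReal_rpow_of_pos hIr, Real.enorm_eq_ofReal_abs,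
    ENNReal.ofReal_rpow_of_nonneg (abs_nonneg _) (by positivity), ← ENNReal.ofReal.eq_1,
    ← ENNReal.ofReal_mul (by positivity), ← ENNReal.ofReal_mul (by positivity)]
  congr 1
  rw [show |u x| = 2 * b by rw [hb]; ring, Real.mul_rpow (by positivity) hb0.le,
    Real.div_rpow hb0.le (by positivity), hRe,
    show 2 * m / ω = m * (2 / ω) by ring, Real.mul_rpow hm0.le (by positivity),
    Real.rpow_add hb0, Real.rpow_add hm0, Real.rpow_one, Real.rpow_mul hb0.le, hm,
    Real.div_rpow hIr.le (by positivity)]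
  field_simp

/-- The pointwise bound is integrated in `x`; by Tonelli the last factor becomes `[u]^p ≤ 1`. -/
lemma exists_lintegral_rpow_le {n : ℕ} (hn : 0 < n) {s t : ℝ} (hs : 0 < s) (ht : 0 < t)
    {p : ℝ≥0∞} (hp0 : p ≠ 0) (hp : p ≠ ∞) :
    ∃ C : ℝ≥0, ∀ u : EuclideanSpace ℝ (Fin n) → ℝ, Continuous u →
      ∫⁻ y, ‖u y‖ₑ ^ t ≠ ∞ → gagliardo n s p u ≤ 1 →
      ∫⁻ x, ‖u x‖ₑ ^ (p.toReal + t * (s * p.toReal / n)) ≤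
        C * (∫⁻ y, ‖u y‖ₑ ^ t) ^ (s * p.toReal / n) := by
  obtain ⟨C, hC⟩ := rpow_enorm_le_lintegral_diffQuot hn hs ht hp0 hp
  refine ⟨C, fun u hu hI hg => ?_⟩
  have hmeas := diffQuot_measurable s p hu
  have h1 : ∫⁻ x, ∫⁻ y, ‖diffQuot n s p u (x, y)‖ₑ ^ p.toReal ≤ 1 := by
    rw [← lintegral_prod (fun z => ‖diffQuot n s p u z‖ₑ ^ p.toReal) (by fun_prop),
      lintegral_enorm_rpow_toReal _ hp0 hp]
    exact ENNReal.rpow_le_one hg ENNReal.toReal_nonneg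
  refine (lintegral_mono (hC u hu hI)).trans ?_
  rw [lintegral_const_mul' _ _ (ENNReal.mul_ne_top ENNReal.coe_ne_top
    (ENNReal.rpow_ne_top_of_nonneg (by positivity) hI))]
  exact mul_le_of_le_one_right' h1

variable {n : ℕ}

lemma toReal_critExp {s : Set.Ioo (0 : ℝ) 1} {p : ℝ≥0∞} (h : ENNReal.ofReal s * p < n) :
    (critExp n s p).toReal = n * p.toReal / (n - s * p.toReal) := by
  rw [critExp, ENNReal.toReal_div, ENNReal.toReal_mul,
    ENNReal.toReal_sub_of_le h.le (ENNReal.natCast_ne_top n), ENNReal.toReal_mul,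
    ENNReal.toReal_natCast, ENNReal.toReal_ofReal s.2.1.le]

/-- The fractional Sobolev inequality. -/
lemma exists_eLpNorm_critExp_le (hn : 0 < n) (s : Set.Ioo (0 : ℝ) 1) {p : ℝ≥0∞} (hp0 : p ≠ 0)
    (hp : p ≠ ∞) (h : ENNReal.ofReal s * p < n) :
    critExp n s p ≠ 0 ∧ critExp n s p ≠ ∞ ∧ ∃ K : ℝ≥0∞, K ≠ ∞ ∧ ∀ u ∈ C1c n,
      gagliardo n s p u ≤ 1 → eLpNorm u (critExp n s p) volume ≤ K := by
  have hs : (0 : ℝ) < s := s.2.1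
  have hP : 0 < p.toReal := ENNReal.toReal_pos hp0 hp
  have hn' : (0 : ℝ) < n := Nat.cast_pos.2 hn
  have hlt : s * p.toReal < n := by
    have := (ENNReal.toReal_lt_toReal h.ne_top (ENNReal.natCast_ne_top n)).2 h
    rwa [ENNReal.toReal_mul, ENNReal.toReal_natCast, ENNReal.toReal_ofReal hs.le] at this
  set P := p.toReal with hPdef
  have hsub : 0 < (n : ℝ) - s * P := sub_pos.2 hlt
  set t := (critExp n s p).toReal with ht
  have htP : t = n * P / (n - s * P) := toReal_critExp h
  have ht0 : 0 < t := by rw [htP]; positivity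
  have hc := ENNReal.toReal_pos_iff.1 ht0
  refine ⟨hc.1.ne', hc.2.ne, ?_⟩
  obtain ⟨C, hC⟩ := exists_lintegral_rpow_le hn hs ht0 hp0 hp
  set σ : ℝ := s * P / n with hσ
  have hσ0 : 0 < σ := by positivity
  have hσ1 : 0 < 1 - σ := by
    rw [hσ, sub_pos, div_lt_one hn']
    exact hlt
  -- The critical exponent is the fixed point of `t ↦ P + tσ`.
  have he : P + t * σ = t := by
    have : (n : ℝ) - P * s ≠ 0 := by rw [mul_comm]; exact hsub.ne'
    rw [htP, hσ, mul_comm (s : ℝ)]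
    field_simp
    ring
  refine ⟨((C : ℝ≥0∞) ^ (1 - σ)⁻¹) ^ (1 / t), ENNReal.rpow_ne_top_of_nonneg (by positivity)
    (ENNReal.rpow_ne_top_of_nonneg (by positivity) ENNReal.coe_ne_top), fun u hu hg => ?_⟩
  rw [eLpNorm_eq_lintegral_rpow_enorm_toReal hc.1.ne' hc.2.ne]
  have hI : ∫⁻ y, ‖u y‖ₑ ^ t ≠ ∞ := by
    rw [ht, lintegral_enorm_rpow_toReal u hc.1.ne' hc.2.ne]
    exact ENNReal.rpow_ne_top_of_nonneg ht0.le (C1c.memLp hu _).2.ne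
  have h1 := hC u hu.1.continuous hI hg
  rw [he] at h1
  refine ENNReal.rpow_le_rpow ?_ (by positivity)
  change ∫⁻ y, ‖u y‖ₑ ^ t ≤ _
  set I := ∫⁻ y, ‖u y‖ₑ ^ t with hIdef
  rcases eq_or_ne I 0 with h0 | h0
  · rw [h0]; exact zero_le
  -- From `I ≤ C I^σ`, division by `I^σ` gives `I^(1-σ) ≤ C`; this needs `I` nonzero and finite.
  rw [← ENNReal.rpow_le_rpow_iff hσ1, ENNReal.rpow_inv_rpow hσ1.ne',
    ENNReal.rpow_sub _ _ h0 hI, ENNReal.rpow_one]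
  exact ENNReal.div_le_of_le_mul h1

/-- Here `σ = 1`, so each step passes linearly from exponent `t` to `t + p`. -/
lemma exists_lintegral_rpow_add_le (hn : 0 < n) (s : Set.Ioo (0 : ℝ) 1) {p q : ℝ≥0∞}
    (hp0 : p ≠ 0) (hp : p ≠ ∞) (hq0 : q ≠ 0) (hq : q ≠ ∞) (h : s * p.toReal = n) (k : ℕ) :
    ∃ K : ℝ≥0∞, K ≠ ∞ ∧ ∀ u ∈ C1c n, eLpNorm u q volume ≤ 1 → gagliardo n s p u ≤ 1 →
      ∫⁻ x, ‖u x‖ₑ ^ (q.toReal + k * p.toReal) ≤ K := by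
  have hn' : (0 : ℝ) < n := Nat.cast_pos.2 hn
  have hQ : 0 < q.toReal := ENNReal.toReal_pos hq0 hq
  have hP : 0 < p.toReal := ENNReal.toReal_pos hp0 hp
  induction k with
  | zero =>
    refine ⟨1, ENNReal.one_ne_top, fun u _ hu _ => ?_⟩
    rw [Nat.cast_zero, zero_mul, add_zero, lintegral_enorm_rpow_toReal u hq0 hq]
    exact ENNReal.rpow_le_one hu hQ.le
  | succ k ih =>
    obtain ⟨K, hK, ih⟩ := ih
    obtain ⟨C, hC⟩ := exists_lintegral_rpow_le hn s.2.1
      (by positivity : 0 < q.toReal + k * p.toReal) hp0 hp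
    refine ⟨C * K, ENNReal.mul_ne_top ENNReal.coe_ne_top hK, fun u hu h1 h2 => ?_⟩
    have h3 := ih u hu h1 h2
    have h4 := hC u hu.1.continuous (h3.trans_lt hK.lt_top).ne h2
    rw [h, div_self hn'.ne', ENNReal.rpow_one, mul_one] at h4
    rw [show q.toReal + (k + 1 : ℕ) * p.toReal = p.toReal + (q.toReal + k * p.toReal) by
      push_cast; ring]
    exact h4.trans (by gcongr)

/-! ### Supercritical case: Hölder and sup bounds -/

/-- In the balls of radius `ε |x - y|` about `x` and `y` there are `x'`, `y'` at which the
difference quotient is at most about its `L^p` mean. This controls `u x' - u y'`, while the assumed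
Hölder bound controls the two short differences with a small factor. -/
lemma exists_half_holder (hn : 0 < n) {s : ℝ} {p : ℝ≥0∞} (hp0 : p ≠ 0)
    (hα : 0 < s - (n : ℝ) / p.toReal) :
    ∃ K : ℝ, 0 ≤ K ∧ ∀ u : EuclideanSpace ℝ (Fin n) → ℝ, gagliardo n s p u ≤ 1 → ∀ H : ℝ, 0 ≤ H →
      (∀ x y, |u x - u y| ≤ H * ‖x - y‖ ^ (s - (n : ℝ) / p.toReal)) →
      ∀ x y, |u x - u y| ≤ (H / 2 + K) * ‖x - y‖ ^ (s - (n : ℝ) / p.toReal) := by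
  have : Nonempty (Fin n) := ⟨⟨0, hn⟩⟩
  set ω : ℝ := (volume (Metric.ball (0 : EuclideanSpace ℝ (Fin n)) 1)).toReal with hω
  have hω0 : 0 < ω := ENNReal.toReal_pos (Metric.measure_ball_pos _ _ one_pos).ne'
    measure_ball_lt_top.ne
  set w : ℝ := 1 / p.toReal with hw
  have hw0 : 0 ≤ w := by positivity
  have hnw : (n : ℝ) / p.toReal = n * w := by rw [hw]; ring
  rw [hnw] at hα ⊢
  set α : ℝ := s - n * w with hαdef
  set e : ℝ := n * w + s with he
  have he0 : 0 ≤ e := by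
    have : 0 ≤ n * w := by positivity
    linarith
  -- Chosen so that `ε^α = 1/4`: the two short differences then contribute `H/4` each.
  set ε : ℝ := (1 / 4) ^ (1 / α) with hε
  have hε0 : 0 < ε := by positivity
  have hε1 : ε ≤ 1 := Real.rpow_le_one (by norm_num) (by norm_num) (by positivity)
  have hεα : ε ^ α = 1 / 4 := by
    rw [hε, ← Real.rpow_mul (by norm_num), one_div_mul_cancel hα.ne', Real.rpow_one]
  refine ⟨2 / ((ε ^ n * ω) ^ 2) ^ w * 3 ^ e, by positivity, fun u hu H hH0 hH x y => ?_⟩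
  rcases eq_or_ne x y with rfl | hxy
  · simp [Real.zero_rpow hα.ne']
  set d := ‖x - y‖ with hd
  have hd0 : 0 < d := norm_sub_pos_iff.2 hxy
  have hball : ∀ z : EuclideanSpace ℝ (Fin n),
      volume (Metric.ball z (ε * d)) = ENNReal.ofReal ((ε * d) ^ n * ω) := fun z => by
    rw [Measure.addHaar_ball_of_pos _ _ (by positivity), finrank_euclideanSpace, Fintype.card_fin,
      ENNReal.ofReal_mul (by positivity), hω, ENNReal.ofReal_toReal measure_ball_lt_top.ne]
  set A := Metric.ball x (ε * d) ×ˢ Metric.ball y (ε * d) with hA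
  have hAvol : (volume.prod volume) A = ENNReal.ofReal (((ε * d) ^ n * ω) ^ 2) := by
    rw [hA, Measure.prod_prod, hball, hball, ← ENNReal.ofReal_mul (by positivity), sq]
  -- Any `N > 1` would serve, since the seminorm is at most `1`.
  obtain ⟨⟨x', y'⟩, ⟨hx', hy'⟩, hlt⟩ := exists_mem_norm_mul_measure_rpow_lt (N := 2)
    (f := diffQuot n s p u) (μ := volume.prod volume) hp0 (A := A)
    (measurableSet_ball.prod measurableSet_ball)
    (by rw [hAvol]; exact (ENNReal.ofReal_pos.2 (by positivity)).ne')
    (by rw [hAvol]; exact ENNReal.ofReal_ne_top) two_pos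
    (hu.trans_lt (by simp))
  rw [hAvol, ENNReal.toReal_ofReal (by positivity), ← hw,
    show ((ε * d) ^ n * ω) ^ 2 = (ε ^ n * ω) ^ 2 * d ^ (2 * n) by ring,
    Real.mul_rpow (by positivity) (by positivity), ← Real.rpow_natCast d, ← Real.rpow_mul hd0.le,
    ← lt_div_iff₀ (by positivity)] at hlt
  simp only [Metric.mem_ball', dist_eq_norm] at hx' hy'
  have hd' : ‖x' - y'‖ ≤ 3 * d := by
    have h1 : ‖x' - y'‖ ≤ ‖x - x'‖ + d + ‖y - y'‖ := by
      rw [show x' - y' = -(x - x') + (x - y) + (y - y') by abel]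
      exact (norm_add₃_le).trans_eq (by rw [norm_neg])
    nlinarith
  have hmid : |u x' - u y'| ≤ 2 / ((ε ^ n * ω) ^ 2) ^ w * 3 ^ e * d ^ α := by
    rcases eq_or_ne x' y' with h | h
    · rw [h, sub_self, abs_zero]; positivity
    have h0 : 0 < ‖x' - y'‖ := norm_sub_pos_iff.2 h
    calc |u x' - u y'| = ‖diffQuot n s p u (x', y')‖ * ‖x' - y'‖ ^ e := by
          rw [diffQuot, hnw, Real.norm_eq_abs, abs_div,
            abs_of_pos (Real.rpow_pos_of_pos h0 _)]
          exact (div_mul_cancel₀ _ (by positivity)).symm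
      _ ≤ 2 / (((ε ^ n * ω) ^ 2) ^ w * d ^ (((2 * n : ℕ) : ℝ) * w)) * (3 * d) ^ e := by gcongr
      _ = _ := by
          rw [Real.mul_rpow (by norm_num) hd0.le,
            show e = α + ((2 * n : ℕ) : ℝ) * w by rw [he, hαdef]; push_cast; ring,
            Real.rpow_add hd0]
          field_simp
  have hside : ∀ z z' : EuclideanSpace ℝ (Fin n), ‖z - z'‖ < ε * d →
      |u z - u z'| ≤ H / 4 * d ^ α := fun z z' hz => by
    refine (hH z z').trans ?_
    rw [show H / 4 * d ^ α = H * (ε * d) ^ α by rw [Real.mul_rpow hε0.le hd0.le, hεα]; ring]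
    gcongr
  calc |u x - u y| = |(u x - u x') + (u x' - u y') + -(u y - u y')| := by ring_nf
    _ ≤ |u x - u x'| + |u x' - u y'| + |-(u y - u y')| := abs_add_three _ _ _
    _ ≤ H / 4 * d ^ α + 2 / ((ε ^ n * ω) ^ 2) ^ w * 3 ^ e * d ^ α + H / 4 * d ^ α := by
        rw [abs_neg]
        gcongr
        · exact hside _ _ hx'
        · exact hside _ _ hy'
    _ = _ := by ring

/-- The fractional Morrey inequality. -/
lemma exists_holder (hn : 0 < n) (s : Set.Ioo (0 : ℝ) 1) {p : ℝ≥0∞} (hp0 : p ≠ 0)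
    (hα : 0 < s - (n : ℝ) / p.toReal) :
    ∃ K : ℝ, 0 ≤ K ∧ ∀ u ∈ C1c n, gagliardo n s p u ≤ 1 →
      ∀ x y, |u x - u y| ≤ K * ‖x - y‖ ^ (s - (n : ℝ) / p.toReal) := by
  obtain ⟨K, hK0, hK⟩ := exists_half_holder hn hp0 hα
  refine ⟨2 * K, by positivity, fun u hu hg => ?_⟩
  set α := s - (n : ℝ) / p.toReal with hαdef
  have hα1 : α ≤ 1 := by
    have : 0 ≤ (n : ℝ) / p.toReal := by positivity
    have := s.2.2
    linarith
  obtain ⟨H, hH0, hH⟩ := C1c.exists_bound hu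
  -- `2K` is the fixed point of `H ↦ H/2 + K`. The iteration starts from some finite Hölder
  -- constant, available since `α ≤ 1`, and forgets it in the limit.
  have key : ∀ k : ℕ, ∀ x y, |u x - u y| ≤ (H / 2 ^ k + 2 * K) * ‖x - y‖ ^ α := fun k => by
    induction k with
    | zero =>
      intro x y
      refine (hH x y).trans ?_
      have h1 : min ‖x - y‖ 1 ≤ ‖x - y‖ ^ α := by
        rcases le_total ‖x - y‖ 1 with h | h
        · exact (min_le_left _ _).trans (Real.self_le_rpow_of_le_one (norm_nonneg _) h hα1)
        · exact (min_le_right _ _).trans (Real.one_le_rpow h hα.le)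
      rw [pow_zero, div_one]
      gcongr
      linarith
    | succ k ih =>
      have h1 := hK u hg (H / 2 ^ k + 2 * K) (by positivity) ih
      rwa [show (H / 2 ^ k + 2 * K) / 2 + K = H / 2 ^ (k + 1) + 2 * K by ring] at h1
  intro x y
  have hlim : Tendsto (fun k : ℕ => (H / 2 ^ k + 2 * K) * ‖x - y‖ ^ α) atTop
      (𝓝 ((0 + 2 * K) * ‖x - y‖ ^ α)) :=
    ((tendsto_const_nhds.div_atTop (tendsto_pow_atTop_atTop_of_one_lt one_lt_two)).add_const
      _).mul_const _
  rw [zero_add] at hlim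
  exact ge_of_tendsto' hlim fun k => key k x y

/-- Each unit ball contains a point where `|u|` is bounded through the `L^q` norm; the Hölder bound
carries this to the centre. -/
lemma exists_eLpNorm_top_le (hn : 0 < n) (s : Set.Ioo (0 : ℝ) 1) {p q : ℝ≥0∞} (hp0 : p ≠ 0)
    (hq0 : q ≠ 0) (hα : 0 < s - (n : ℝ) / p.toReal) :
    ∃ K : ℝ≥0∞, K ≠ ∞ ∧ ∀ u ∈ C1c n, eLpNorm u q volume ≤ 1 → gagliardo n s p u ≤ 1 →
      eLpNorm u ∞ volume ≤ K := by
  have : Nonempty (Fin n) := ⟨⟨0, hn⟩⟩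
  obtain ⟨K, hK0, hK⟩ := exists_holder hn s hp0 hα
  set ω : ℝ := (volume (Metric.ball (0 : EuclideanSpace ℝ (Fin n)) 1)).toReal with hω
  have hω0 : 0 < ω := ENNReal.toReal_pos (Metric.measure_ball_pos _ _ one_pos).ne'
    measure_ball_lt_top.ne
  refine ⟨ENNReal.ofReal (K + 2 / ω ^ (1 / q.toReal)), ENNReal.ofReal_ne_top,
    fun u hu hu1 hg => ?_⟩
  rw [eLpNorm_exponent_top]
  refine eLpNormEssSup_le_of_ae_bound (.of_forall fun x => ?_)
  obtain ⟨y, hy, hlt⟩ := exists_mem_norm_mul_measure_rpow_lt (N := 2) (f := u) (μ := volume) hq0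
    (A := Metric.ball x 1) measurableSet_ball (Metric.measure_ball_pos _ _ one_pos).ne'
    measure_ball_lt_top.ne two_pos (hu1.trans_lt (by simp))
  rw [Measure.addHaar_ball_center, ← hω, ← lt_div_iff₀ (by positivity)] at hlt
  rw [Metric.mem_ball', dist_eq_norm] at hy
  have h1 : |u x - u y| ≤ K := (hK u hu hg x y).trans
    (mul_le_of_le_one_right hK0 (Real.rpow_le_one (norm_nonneg _) hy.le hα.le))
  calc ‖u x‖ ≤ ‖u x - u y‖ + ‖u y‖ := norm_le_norm_sub_add _ _
    _ ≤ _ := add_le_add h1 hlt.le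

end FracSobolev

end

/-! ### The three cases of the embedding -/

open FracSobolev in
theorem proposition2 (n : ℕ) (hn : 2 ≤ n) (p q : ℝ≥0∞) [Fact (1 ≤ p)] [Fact (1 ≤ q)]
    (hq : q ≠ ∞) (s : Set.Ioo (0 : ℝ) 1) :
    (ENNReal.ofReal s * p < n → ∀ (r : ℝ≥0∞) [Fact (1 ≤ r)],
      min (critExp n s p) q ≤ r → r ≤ max (critExp n s p) q → EmbedsInLp n s q p r) ∧
    (ENNReal.ofReal s * p = n → ∀ (r : ℝ≥0∞) [Fact (1 ≤ r)],
      q ≤ r → r < ∞ → EmbedsInLp n s q p r) ∧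
    (n < ENNReal.ofReal s * p → ∀ (r : ℝ≥0∞) [Fact (1 ≤ r)],
      q ≤ r → EmbedsInLp n s q p r) := by
  have hn0 : 0 < n := by omega
  have hs : (0 : ℝ) < s := s.2.1
  have hp0 : p ≠ 0 := (zero_lt_one.trans_le Fact.out).ne'
  have hq0 : q ≠ 0 := (zero_lt_one.trans_le Fact.out).ne'
  have htop : ENNReal.ofReal s * p ≠ ∞ → p ≠ ∞ := by
    rintro h rfl
    exact h (ENNReal.mul_top (ENNReal.ofReal_pos.2 hs).ne')
  have hreal : (ENNReal.ofReal s * p).toReal = s * p.toReal := by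
    rw [ENNReal.toReal_mul, ENNReal.toReal_ofReal hs.le]
  refine ⟨fun h r _ hr1 hr2 => ?_, fun h r _ hr1 hr2 => ?_, fun h r _ hr => ?_⟩
  · obtain ⟨hc0, -, K, hK, hKb⟩ := exists_eLpNorm_critExp_le hn0 s hp0 (htop h.ne_top) h
    have hK1 : max K 1 ≠ ∞ := max_ne_top hK ENNReal.one_ne_top
    rcases le_total (critExp n s p) q with hle | hle
    · rw [min_eq_left hle] at hr1
      rw [max_eq_right hle] at hr2
      obtain ⟨K', hK', hb⟩ := exists_eLpNorm_le_of_le_of_le (F := ℝ)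
        (μ := (volume : Measure (EuclideanSpace ℝ (Fin n)))) hc0 hr1 hr2 hK1
      exact embedsInLp_of_eLpNorm_le hK' fun u hu h1 h2 => hb u
        hu.1.continuous.aestronglyMeasurable (le_max_of_le_left (hKb u hu h2))
        (le_max_of_le_right h1)
    · rw [min_eq_right hle] at hr1
      rw [max_eq_left hle] at hr2
      obtain ⟨K', hK', hb⟩ := exists_eLpNorm_le_of_le_of_le (F := ℝ)
        (μ := (volume : Measure (EuclideanSpace ℝ (Fin n)))) hq0 hr1 hr2 hK1
      exact embedsInLp_of_eLpNorm_le hK' fun u hu h1 h2 => hb u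
        hu.1.continuous.aestronglyMeasurable (le_max_of_le_right h1)
        (le_max_of_le_left (hKb u hu h2))
  · have hp : p ≠ ∞ := htop (h ▸ ENNReal.natCast_ne_top n)
    have hsp : s * p.toReal = n := by rw [← hreal, h, ENNReal.toReal_natCast]
    have hP : 0 < p.toReal := ENNReal.toReal_pos hp0 hp
    -- Enough steps that `q + kp ≥ r`; interpolation with `L^q` then gives `L^r`.
    obtain ⟨k, hk⟩ := exists_nat_ge (r.toReal / p.toReal)
    obtain ⟨K, hK, hKb⟩ := exists_lintegral_rpow_add_le hn0 s hp0 hp hq0 hq hsp k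
    set b : ℝ := q.toReal + k * p.toReal with hb
    have hb0 : 0 < b := add_pos_of_pos_of_nonneg (ENNReal.toReal_pos hq0 hq) (by positivity)
    have hrb : r ≤ ENNReal.ofReal b := by
      rw [ENNReal.le_ofReal_iff_toReal_le hr2.ne hb0.le]
      exact ((div_le_iff₀ hP).1 hk).trans (le_add_of_nonneg_left ENNReal.toReal_nonneg)
    obtain ⟨K', hK', hb⟩ := exists_eLpNorm_le_of_le_of_le (F := ℝ)
      (μ := (volume : Measure (EuclideanSpace ℝ (Fin n)))) (K := max (K ^ (1 / b)) 1) hq0 hr1 hrb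
      (max_ne_top (ENNReal.rpow_ne_top_of_nonneg (by positivity) hK) ENNReal.one_ne_top)
    refine embedsInLp_of_eLpNorm_le hK' fun u hu h1 h2 => hb u
      hu.1.continuous.aestronglyMeasurable (le_max_of_le_right h1) (le_max_of_le_left ?_)
    rw [eLpNorm_eq_lintegral_rpow_enorm_toReal (ENNReal.ofReal_pos.2 hb0).ne'
      ENNReal.ofReal_ne_top, ENNReal.toReal_ofReal hb0.le]
    exact ENNReal.rpow_le_rpow (hKb u hu h1 h2) (by positivity)
  · have hα : 0 < s - (n : ℝ) / p.toReal := by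
      rcases eq_or_ne p ∞ with rfl | hp
      · simpa using hs
      have h1 := (ENNReal.toReal_lt_toReal (ENNReal.natCast_ne_top n)
        (ENNReal.mul_ne_top ENNReal.ofReal_ne_top hp)).2 h
      rw [hreal, ENNReal.toReal_natCast] at h1
      rwa [sub_pos, div_lt_iff₀ (ENNReal.toReal_pos hp0 hp)]
    obtain ⟨K, hK, hKb⟩ := exists_eLpNorm_top_le hn0 s hp0 hq0 hα
    obtain ⟨K', hK', hb⟩ := exists_eLpNorm_le_of_le_of_le (F := ℝ)
      (μ := (volume : Measure (EuclideanSpace ℝ (Fin n)))) hq0 hr le_top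
      (max_ne_top hK ENNReal.one_ne_top : max K 1 ≠ ∞)
    exact embedsInLp_of_eLpNorm_le hK' fun u hu h1 h2 => hb u
      hu.1.continuous.aestronglyMeasurable (le_max_of_le_right h1)
      (le_max_of_le_left (hKb u hu h1 h2))
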